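/- **Epstein's Theorem.** Let $n\ge 0$ be an integer, let $B\in M_n(\mathbb C)$ be any complex $n\times n$ matrix, and let $0\le p\le 1$. Let $M_n^+(\mathbb C)$ denote the convex cone of positive semidefinite matrices in $M_n(\mathbb C)$, and for $X\in M_n^+(\mathbb C)$ and real $r\ge 0$ let $X^r$ be defined by the spectral functional calculus (with $X^0=I$). Then the real-valued map $$A\longmapsto \operatorname{tr}\big[(B^*A^pB)^{1/p}\big]$$ is concave on $M_n^+(\mathbb C)$: for all $A_1,A_2\in M_n^+(\mathbb C)$ and $0\le\lambda\le1$, $$\lambda\operatorname{tr}\big[(B^*A_1^pB)^{1/p}\big]+(1-\lambda)\operatorname{tr}\big[(B^*A_2^pB)^{1/p}\big]\le \operatorname{tr}\Big[\big(B^*(\lambda A_1+(1-\lambda)A_2)^pB\big)^{1/p}\Big].$$ The substance is the range $0<p\le 1$. For $p=0$ the exponent $1/p$ is read as $0$ by convention, and the map is then constant and so trivially concave. -/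

import Mathlib

open scoped Matrix MatrixOrder ComplexOrder

/-- The functional `A ↦ tr[(Bᴴ A ^ p B) ^ (1/p)]`. Real powers of matrices are taken in the
continuous functional calculus (`CFC.rpow`). For positive semidefinite `A` the matrix
`(Bᴴ A ^ p B) ^ (1/p)` is positive semidefinite, so its trace is real and `re` loses nothing;
see `ofReal_epsteinTrace`. -/
noncomputable def epsteinTrace {n : ℕ} (B : Matrix (Fin n) (Fin n) ℂ) (p : ℝ)
    (A : Matrix (Fin n) (Fin n) ℂ) : ℝ :=
  (((Bᴴ * A ^ p * B) ^ (1 / p)).trace).re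

/-- Taking the real part in `epsteinTrace` is harmless: the trace is a real number. -/
theorem ofReal_epsteinTrace {n : ℕ} (B : Matrix (Fin n) (Fin n) ℂ) (p : ℝ)
    (A : Matrix (Fin n) (Fin n) ℂ) :
    (epsteinTrace B p A : ℂ) = ((Bᴴ * A ^ p * B) ^ (1 / p)).trace := by
  have h : (0 : Matrix (Fin n) (Fin n) ℂ) ≤ (Bᴴ * A ^ p * B) ^ (1 / p) := CFC.rpow_nonneg
  have h2 := (Matrix.nonneg_iff_posSemidef.mp h).trace_nonneg
  exact Complex.ext rfl (by simpa using (Complex.le_def.mp h2).2)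

/-!
Fix `p ∈ (0, 1]`. By Young's inequality, for positive semidefinite `Y`,

  `p tr Y ^ (1/p) = max {tr (Y X ^ (1-p)) - (1-p) tr X | X ≥ 0}`,

the maximum being attained at `X = Y ^ (1/p)`. For `Y = Bᴴ A ^ p B` the expression inside the
maximum is jointly concave in `(A, X)` by Lieb's concavity theorem, and a partial maximum of a
jointly concave function is concave.

Lieb's theorem in turn follows from
`a ^ p x ^ (1-p) = ∫ t ^ (p-2) (a · tx / (a + tx)) dμ(t)`, applied to left multiplication by `A`
and right multiplication by `X`: the parallel sum of two commuting positive operators is an infimum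
of quadratic forms that depend linearly on the operators, hence it is jointly concave.
-/

open MeasureTheory Set

section ConcaveOn

variable {R E F β ι : Type*} [Semiring R] [PartialOrder R] [AddCommMonoid E] [AddCommMonoid F]
  [AddCommMonoid β] [SMul R E] [SMul R F]

theorem concaveOn_of_forall_isGreatest_image [PartialOrder β] [SMul R β] {s : Set E} {t : Set F}
    {f : E × F → β} {g : E → β} (hf : ConcaveOn R (s ×ˢ t) f)
    (hg : ∀ x ∈ s, IsGreatest ((fun y => f (x, y)) '' t) (g x)) : ConcaveOn R s g := by
  choose y hy hfy using fun x hx => (hg x hx).1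
  have hmem {x₁ x₂ : E} (hx₁ : x₁ ∈ s) (hx₂ : x₂ ∈ s) {c d : R} (hc : 0 ≤ c) (hd : 0 ≤ d)
      (hcd : c + d = 1) : c • (x₁, y x₁ hx₁) + d • (x₂, y x₂ hx₂) ∈ s ×ˢ t :=
    hf.1 (mk_mem_prod hx₁ (hy x₁ hx₁)) (mk_mem_prod hx₂ (hy x₂ hx₂)) hc hd hcd
  refine ⟨fun x₁ hx₁ x₂ hx₂ c d hc hd hcd => (hmem hx₁ hx₂ hc hd hcd).1,
    fun x₁ hx₁ x₂ hx₂ c d hc hd hcd => ?_⟩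
  have hxy := hmem hx₁ hx₂ hc hd hcd
  calc c • g x₁ + d • g x₂
      = c • f (x₁, y x₁ hx₁) + d • f (x₂, y x₂ hx₂) := by rw [← hfy x₁ hx₁, ← hfy x₂ hx₂]
    _ ≤ f (c • (x₁, y x₁ hx₁) + d • (x₂, y x₂ hx₂)) :=
        hf.2 (mk_mem_prod hx₁ (hy x₁ hx₁)) (mk_mem_prod hx₂ (hy x₂ hx₂)) hc hd hcd
    _ ≤ g (c • x₁ + d • x₂) := (hg _ hxy.1).2 (mem_image_of_mem _ hxy.2)

theorem concaveOn_iInf [ConditionallyCompleteLattice β] [IsOrderedAddMonoid β] [Module R β]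
    [PosSMulMono R β] [Nonempty ι] {s : Set E} {f : ι → E → β} (hf : ∀ i, ConcaveOn R s (f i))
    (hbdd : ∀ x ∈ s, BddBelow (range fun i => f i x)) : ConcaveOn R s fun x => ⨅ i, f i x := by
  refine ⟨(hf (Classical.arbitrary ι)).1, fun x hx y hy c d hc hd hcd => le_ciInf fun i => ?_⟩
  calc c • (⨅ i, f i x) + d • (⨅ i, f i y)
      ≤ c • f i x + d • f i y := by
        gcongr
        exacts [ciInf_le (hbdd x hx) i, ciInf_le (hbdd y hy) i]
    _ ≤ f i (c • x + d • y) := (hf i).2 hx hy hc hd hcd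

end ConcaveOn

theorem rpow_add_of_exponent_nonneg {A : Type*} [PartialOrder A] [Ring A] [StarRing A]
    [TopologicalSpace A] [StarOrderedRing A] [Algebra ℝ A]
    [ContinuousFunctionalCalculus ℝ A IsSelfAdjoint] [NonnegSpectrumClass ℝ A]
    (a : A) {x y : ℝ} (hx : 0 ≤ x) (hy : 0 ≤ y) : a ^ (x + y) = a ^ x * a ^ y := by
  simp only [CFC.rpow_def, NNReal.rpow_add_of_nonneg _ hx hy]
  exact cfc_mul _ _ a

theorem isLeast_range_mul_norm_sub_sq_add_mul_norm_sq {E : Type*} [NormedAddCommGroup E]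
    [NormedSpace ℝ E] {a x : ℝ} (ha : 0 ≤ a) (hx : 0 ≤ x) (k : E) :
    IsLeast (range fun z => a * ‖k - z‖ ^ 2 + x * ‖z‖ ^ 2) (a * x / (a + x) * ‖k‖ ^ 2) := by
  rcases (add_nonneg ha hx).eq_or_lt with h | h
  · obtain ⟨rfl, rfl⟩ := (add_eq_zero_iff_of_nonneg ha hx).1 h.symm
    simp
  refine ⟨⟨(a / (a + x)) • k, ?_⟩, ?_⟩
  · have hk : k - (a / (a + x)) • k = (x / (a + x)) • k := by
      rw [sub_eq_iff_eq_add, ← add_smul, ← add_div, add_comm x, div_self h.ne', one_smul]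
    simp only [hk, norm_smul, mul_pow, Real.norm_eq_abs, sq_abs]
    field_simp
    ring
  · rintro _ ⟨z, rfl⟩
    have htri : ‖k‖ ≤ ‖k - z‖ + ‖z‖ := by simpa using norm_add_le (k - z) z
    calc a * x / (a + x) * ‖k‖ ^ 2
        ≤ a * x / (a + x) * (‖k - z‖ + ‖z‖) ^ 2 := by gcongr
      _ = a * ‖k - z‖ ^ 2 + x * ‖z‖ ^ 2 - (a * ‖k - z‖ - x * ‖z‖) ^ 2 / (a + x) := by
        field_simp
        ring
      _ ≤ a * ‖k - z‖ ^ 2 + x * ‖z‖ ^ 2 := sub_le_self _ (by positivity)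

theorem mul_rpowIntegrand₀₁_div {p t a x : ℝ} (hp : p ∈ Ioo 0 1) (ht : 0 < t) (ha : 0 ≤ a)
    (hx : 0 ≤ x) :
    x * Real.rpowIntegrand₀₁ p t (a / x) = t ^ (p - 2) * (a * (t * x) / (a + t * x)) := by
  rw [Real.rpowIntegrand₀₁_eq_pow_div hp ht.le (by positivity)]
  rcases hx.eq_or_lt with rfl | hx
  · simp
  · rw [show p - 1 = p - 2 + 1 by ring, Real.rpow_add_one ht.ne']
    field_simp
    ring

theorem rpow_mul_rpow_one_sub {p a x : ℝ} (hp : p < 1) (ha : 0 ≤ a) (hx : 0 ≤ x) :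
    a ^ p * x ^ (1 - p) = x * (a / x) ^ p := by
  rcases hx.eq_or_lt with rfl | hx
  · simp [Real.zero_rpow (sub_pos.2 hp).ne']
  · rw [Real.div_rpow ha hx.le, Real.rpow_sub hx, Real.rpow_one]
    ring

theorem exists_measure_rpow_mul_rpow_one_sub_eq_integral {p : ℝ} (hp : p ∈ Ioo 0 1) :
    ∃ μ : Measure ℝ, ∀ a x : ℝ, 0 ≤ a → 0 ≤ x →
      IntegrableOn (fun t => t ^ (p - 2) * (a * (t * x) / (a + t * x))) (Ioi 0) μ ∧
      a ^ p * x ^ (1 - p) = ∫ t in Ioi 0, t ^ (p - 2) * (a * (t * x) / (a + t * x)) ∂μ := by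
  obtain ⟨μ, hμ⟩ := Real.exists_measure_rpow_eq_integral_rpowIntegrand₀₁ hp
  refine ⟨μ, fun a x ha hx => ?_⟩
  obtain ⟨hint, heq⟩ := hμ (a / x) (div_nonneg ha hx)
  have hcongr : EqOn (fun t => x * Real.rpowIntegrand₀₁ p t (a / x))
      (fun t => t ^ (p - 2) * (a * (t * x) / (a + t * x))) (Ioi 0) :=
    fun t ht => mul_rpowIntegrand₀₁_div hp ht ha hx
  refine ⟨IntegrableOn.congr_fun (hint.const_mul x) hcongr measurableSet_Ioi, ?_⟩
  rw [rpow_mul_rpow_one_sub hp.2 ha hx, heq, ← integral_const_mul,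
    setIntegral_congr_fun measurableSet_Ioi hcongr]

theorem mul_rpow_one_sub_le {p y x : ℝ} (hp : p ∈ Ioc 0 1) (hy : 0 ≤ y) (hx : 0 ≤ x) :
    y * x ^ (1 - p) ≤ p * y ^ (1 / p) + (1 - p) * x := by
  have h := Real.geom_mean_le_arith_mean2_weighted hp.1.le (sub_nonneg.2 hp.2)
    (Real.rpow_nonneg hy (1 / p)) hx (add_sub_cancel p 1)
  rwa [← Real.rpow_mul hy, one_div_mul_cancel hp.1.ne', Real.rpow_one] at h

variable {𝕜 m n : Type*} [RCLike 𝕜]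

theorem convex_setOf_posSemidef : Convex ℝ {A : Matrix m m 𝕜 | A.PosSemidef} :=
  fun _ hA _ hB _ _ hc hd _ => (hA.smul hc).add (hB.smul hd)

variable [Fintype n]

theorem convexOn_mul_re_trace_snd {s : Set (Matrix m m 𝕜 × Matrix n n 𝕜)} (hs : Convex ℝ s)
    (c : ℝ) : ConvexOn ℝ s fun P => c * RCLike.re P.2.trace := by
  refine ⟨hs, fun P _ Q _ a b _ _ _ => le_of_eq ?_⟩
  simp only [Prod.snd_add, Prod.smul_snd, Matrix.trace_add, Matrix.trace_smul, map_add,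
    RCLike.smul_re, smul_eq_mul]
  ring

variable [Fintype m]

theorem concaveOn_re_trace_add_re_trace_smul {s : Set (Matrix m m 𝕜 × Matrix n n 𝕜)}
    (hs : Convex ℝ s) (K L : Matrix m n 𝕜) (t : ℝ) :
    ConcaveOn ℝ s fun P =>
      RCLike.re (Kᴴ * P.1 * K).trace + RCLike.re (Lᴴ * L * (t • P.2)).trace := by
  refine ⟨hs, fun P _ Q _ c d _ _ _ => le_of_eq ?_⟩
  simp only [Prod.fst_add, Prod.snd_add, Prod.smul_fst, Prod.smul_snd, mul_add,
    Matrix.mul_smul, Matrix.smul_mul, Matrix.mul_add, Matrix.add_mul, Matrix.trace_add,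
    Matrix.trace_smul, map_add, RCLike.smul_re, smul_eq_mul]
  ring

theorem re_trace_conjTranspose_mul_diagonal_mul_mul_diagonal [DecidableEq m] [DecidableEq n]
    (L : Matrix m n 𝕜) (d : m → ℝ) (e : n → ℝ) :
    RCLike.re (Lᴴ * Matrix.diagonal (RCLike.ofReal ∘ d : m → 𝕜) * L *
      Matrix.diagonal (RCLike.ofReal ∘ e : n → 𝕜)).trace = ∑ i, ∑ j, d i * e j * ‖L i j‖ ^ 2 := by
  rw [Finset.sum_comm]
  simp only [Matrix.trace, Matrix.diag_apply, Matrix.mul_diagonal, map_sum]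
  refine Finset.sum_congr rfl fun j _ => ?_
  rw [Matrix.mul_apply]
  simp only [Matrix.mul_diagonal, Matrix.conjTranspose_apply, Finset.sum_mul, map_sum,
    Function.comp_apply]
  refine Finset.sum_congr rfl fun i _ => ?_
  rw [mul_right_comm (star (L i j)), RCLike.star_def, RCLike.conj_mul]
  norm_cast
  ring

/-- The infimum `⨅ Z, tr ((K - Z)ᴴ A (K - Z)) + tr (Zᴴ Z X)`. For positive semidefinite `A` and `X`
it is the quadratic form at `K` of the parallel sum (half the harmonic mean) of the commuting
operators `Z ↦ A Z` and `Z ↦ Z X`. -/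
noncomputable def parallelSumForm (A : Matrix m m 𝕜) (X : Matrix n n 𝕜) (K : Matrix m n 𝕜) : ℝ :=
  ⨅ Z : Matrix m n 𝕜,
    RCLike.re ((K - Z)ᴴ * A * (K - Z)).trace + RCLike.re (Zᴴ * Z * X).trace

section Eigenbasis

variable [DecidableEq m] [DecidableEq n] {A : Matrix m m 𝕜} {X : Matrix n n 𝕜}

/-- The matrix `Uᴴ K V` of `K` with respect to the orthonormal eigenbases `V` of `X` and `U` of
`A`, as a linear automorphism in `K`. -/
noncomputable def eigenbasisCoords (hA : A.IsHermitian) (hX : X.IsHermitian) :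
    Matrix m n 𝕜 ≃ₗ[𝕜] Matrix m n 𝕜 where
  toFun K :=
    star (hA.eigenvectorUnitary : Matrix m m 𝕜) * K * (hX.eigenvectorUnitary : Matrix n n 𝕜)
  invFun K :=
    (hA.eigenvectorUnitary : Matrix m m 𝕜) * K * star (hX.eigenvectorUnitary : Matrix n n 𝕜)
  map_add' K L := by rw [Matrix.mul_add, Matrix.add_mul]
  map_smul' c K := by rw [Matrix.mul_smul, Matrix.smul_mul, RingHom.id_apply]
  left_inv K := by
    beta_reduce
    rw [← Matrix.mul_assoc, ← Matrix.mul_assoc, Unitary.mul_star_self_of_mem (SetLike.coe_mem _),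
      Matrix.one_mul, Matrix.mul_assoc, Unitary.mul_star_self_of_mem (SetLike.coe_mem _),
      Matrix.mul_one]
  right_inv K := by
    beta_reduce
    rw [← Matrix.mul_assoc, ← Matrix.mul_assoc, Unitary.star_mul_self_of_mem (SetLike.coe_mem _),
      Matrix.one_mul, Matrix.mul_assoc, Unitary.star_mul_self_of_mem (SetLike.coe_mem _),
      Matrix.mul_one]

theorem re_trace_cfc_mul_cfc (hA : A.IsHermitian) (hX : X.IsHermitian) (f g : ℝ → ℝ)
    (K : Matrix m n 𝕜) :
    RCLike.re (Kᴴ * cfc f A * K * cfc g X).trace =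
      ∑ i, ∑ j, f (hA.eigenvalues i) * g (hX.eigenvalues j) *
        ‖eigenbasisCoords hA hX K i j‖ ^ 2 := by
  refine Eq.trans ?_ (re_trace_conjTranspose_mul_diagonal_mul_mul_diagonal
    (eigenbasisCoords hA hX K) (f ∘ hA.eigenvalues) (g ∘ hX.eigenvalues))
  rw [hA.cfc_eq, hX.cfc_eq, Matrix.IsHermitian.cfc, Matrix.IsHermitian.cfc,
    Unitary.conjStarAlgAut_apply, Unitary.conjStarAlgAut_apply, ← Matrix.mul_assoc,
    Matrix.trace_mul_comm]
  simp only [eigenbasisCoords, LinearEquiv.coe_mk, LinearMap.coe_mk, AddHom.coe_mk,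
    Matrix.conjTranspose_mul, Matrix.star_eq_conjTranspose, Matrix.conjTranspose_conjTranspose,
    Matrix.mul_assoc]

theorem re_trace_conjTranspose_mul_mul (hA : A.IsHermitian) (hX : X.IsHermitian)
    (K : Matrix m n 𝕜) :
    RCLike.re (Kᴴ * A * K).trace =
      ∑ i, ∑ j, hA.eigenvalues i * ‖eigenbasisCoords hA hX K i j‖ ^ 2 := by
  simpa [cfc_id' ℝ A hA.isSelfAdjoint, cfc_const_one ℝ X hX.isSelfAdjoint] using
    re_trace_cfc_mul_cfc hA hX (fun a => a) (fun _ => 1) K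

theorem re_trace_conjTranspose_mul_self_mul (hA : A.IsHermitian) (hX : X.IsHermitian)
    (K : Matrix m n 𝕜) :
    RCLike.re (Kᴴ * K * X).trace =
      ∑ i, ∑ j, hX.eigenvalues j * ‖eigenbasisCoords hA hX K i j‖ ^ 2 := by
  simpa [cfc_id' ℝ X hX.isSelfAdjoint, cfc_const_one ℝ A hA.isSelfAdjoint] using
    re_trace_cfc_mul_cfc hA hX (fun _ => 1) (fun x => x) K

theorem re_trace_rpow_mul_rpow (hA : A.PosSemidef) (hX : X.PosSemidef) (p q : ℝ)
    (K : Matrix m n 𝕜) :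
    RCLike.re (Kᴴ * A ^ p * K * X ^ q).trace =
      ∑ i, ∑ j, hA.1.eigenvalues i ^ p * hX.1.eigenvalues j ^ q *
        ‖eigenbasisCoords hA.1 hX.1 K i j‖ ^ 2 := by
  rw [CFC.rpow_eq_cfc_real hA.nonneg, CFC.rpow_eq_cfc_real hX.nonneg, re_trace_cfc_mul_cfc]

theorem isLeast_range_parallelSumForm (hA : A.PosSemidef) (hX : X.PosSemidef) {t : ℝ} (ht : 0 ≤ t)
    (K : Matrix m n 𝕜) :
    IsLeast
      (range fun Z =>
        RCLike.re ((K - Z)ᴴ * A * (K - Z)).trace + RCLike.re (Zᴴ * Z * (t • X)).trace)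
      (∑ i, ∑ j, hA.1.eigenvalues i * (t * hX.1.eigenvalues j) /
        (hA.1.eigenvalues i + t * hX.1.eigenvalues j) *
          ‖eigenbasisCoords hA.1 hX.1 K i j‖ ^ 2) := by
  have hentry i j := isLeast_range_mul_norm_sub_sq_add_mul_norm_sq (hA.eigenvalues_nonneg i)
    (mul_nonneg ht (hX.eigenvalues_nonneg j)) (eigenbasisCoords hA.1 hX.1 K i j)
  have hsum (Z : Matrix m n 𝕜) :
      RCLike.re ((K - Z)ᴴ * A * (K - Z)).trace + RCLike.re (Zᴴ * Z * (t • X)).trace =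
        ∑ i, ∑ j, (hA.1.eigenvalues i *
          ‖eigenbasisCoords hA.1 hX.1 K i j - eigenbasisCoords hA.1 hX.1 Z i j‖ ^ 2 +
            t * hX.1.eigenvalues j * ‖eigenbasisCoords hA.1 hX.1 Z i j‖ ^ 2) := by
    rw [Matrix.mul_smul, Matrix.trace_smul, RCLike.smul_re,
      re_trace_conjTranspose_mul_mul hA.1 hX.1, re_trace_conjTranspose_mul_self_mul hA.1 hX.1]
    simp only [map_sub, Matrix.sub_apply, Finset.mul_sum, Finset.sum_add_distrib, mul_assoc]
  simp only [hsum]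
  constructor
  · choose W hW using fun i j => (hentry i j).1
    refine ⟨(eigenbasisCoords hA.1 hX.1).symm (Matrix.of W), ?_⟩
    simp only [LinearEquiv.apply_symm_apply, Matrix.of_apply, hW]
  · rintro _ ⟨Z, rfl⟩
    exact Finset.sum_le_sum fun i _ => Finset.sum_le_sum fun j _ =>
      (hentry i j).2 (mem_range_self _)

theorem parallelSumForm_smul (hA : A.PosSemidef) (hX : X.PosSemidef) {t : ℝ} (ht : 0 ≤ t)
    (K : Matrix m n 𝕜) :
    parallelSumForm A (t • X) K =
      ∑ i, ∑ j, hA.1.eigenvalues i * (t * hX.1.eigenvalues j) /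
        (hA.1.eigenvalues i + t * hX.1.eigenvalues j) *
          ‖eigenbasisCoords hA.1 hX.1 K i j‖ ^ 2 :=
  (isLeast_range_parallelSumForm hA hX ht K).csInf_eq

end Eigenbasis

theorem concaveOn_parallelSumForm_smul {t : ℝ} (ht : 0 ≤ t) (K : Matrix m n 𝕜) :
    ConcaveOn ℝ ({A : Matrix m m 𝕜 | A.PosSemidef} ×ˢ {X : Matrix n n 𝕜 | X.PosSemidef})
      fun P => parallelSumForm P.1 (t • P.2) K := by
  classical
  exact concaveOn_iInf
    (fun Z => concaveOn_re_trace_add_re_trace_smul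
      (convex_setOf_posSemidef.prod convex_setOf_posSemidef) (K - Z) Z t)
    fun _ hP => (isLeast_range_parallelSumForm hP.1 hP.2 ht K).bddBelow

variable [DecidableEq m] [DecidableEq n]

theorem exists_measure_re_trace_rpow_mul_rpow_eq_integral {p : ℝ} (hp : p ∈ Ioo 0 1)
    (K : Matrix m n 𝕜) :
    ∃ μ : Measure ℝ, ∀ (A : Matrix m m 𝕜) (X : Matrix n n 𝕜), A.PosSemidef → X.PosSemidef →
      IntegrableOn (fun t => t ^ (p - 2) * parallelSumForm A (t • X) K) (Ioi 0) μ ∧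
      RCLike.re (Kᴴ * A ^ p * K * X ^ (1 - p)).trace =
        ∫ t in Ioi 0, t ^ (p - 2) * parallelSumForm A (t • X) K ∂μ := by
  obtain ⟨μ, hμ⟩ := exists_measure_rpow_mul_rpow_one_sub_eq_integral hp
  refine ⟨μ, fun A X hA hX => ?_⟩
  have hscalar i j := hμ _ _ (hA.eigenvalues_nonneg i) (hX.eigenvalues_nonneg j)
  have hint i j := (hscalar i j).1.mul_const (‖eigenbasisCoords hA.1 hX.1 K i j‖ ^ 2)
  have hsum : EqOn (fun t => ∑ i, ∑ j, t ^ (p - 2) * (hA.1.eigenvalues i *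
        (t * hX.1.eigenvalues j) / (hA.1.eigenvalues i + t * hX.1.eigenvalues j)) *
          ‖eigenbasisCoords hA.1 hX.1 K i j‖ ^ 2)
      (fun t => t ^ (p - 2) * parallelSumForm A (t • X) K) (Ioi 0) := fun t ht => by
    simp only [parallelSumForm_smul hA hX (le_of_lt ht), Finset.mul_sum, mul_assoc]
  constructor
  · exact IntegrableOn.congr_fun
      (integrable_finsetSum _ fun i _ => integrable_finsetSum _ fun j _ => hint i j) hsum
      measurableSet_Ioi
  · rw [← setIntegral_congr_fun measurableSet_Ioi hsum, re_trace_rpow_mul_rpow hA hX,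
      integral_finsetSum _ fun i _ => integrable_finsetSum _ fun j _ => hint i j]
    refine Finset.sum_congr rfl fun i _ => ?_
    rw [integral_finsetSum _ fun j _ => hint i j]
    refine Finset.sum_congr rfl fun j _ => ?_
    rw [integral_mul_const, (hscalar i j).2]

theorem concaveOn_re_trace_rpow_mul_rpow_of_mem_Ioo {p : ℝ} (hp : p ∈ Ioo 0 1)
    (K : Matrix m n 𝕜) :
    ConcaveOn ℝ ({A : Matrix m m 𝕜 | A.PosSemidef} ×ˢ {X : Matrix n n 𝕜 | X.PosSemidef})
      fun P => RCLike.re (Kᴴ * P.1 ^ p * K * P.2 ^ (1 - p)).trace := by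
  obtain ⟨μ, hμ⟩ := exists_measure_re_trace_rpow_mul_rpow_eq_integral hp K
  have hconcave :
      ConcaveOn ℝ ({A : Matrix m m 𝕜 | A.PosSemidef} ×ˢ {X : Matrix n n 𝕜 | X.PosSemidef})
        fun P => ∫ t in Ioi 0, t ^ (p - 2) * parallelSumForm P.1 (t • P.2) K ∂μ := by
    refine integral_concaveOn_of_integrand_ae
      (f := fun (t : ℝ) (P : Matrix m m 𝕜 × Matrix n n 𝕜) =>
        t ^ (p - 2) * parallelSumForm P.1 (t • P.2) K)
      (convex_setOf_posSemidef.prod convex_setOf_posSemidef) ?_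
      fun P hP => (hμ P.1 P.2 hP.1 hP.2).1
    filter_upwards [ae_restrict_mem measurableSet_Ioi] with t (ht : 0 < t)
    exact (concaveOn_parallelSumForm_smul ht.le K).smul (Real.rpow_nonneg ht.le (p - 2))
  exact hconcave.congr fun P hP => (hμ P.1 P.2 hP.1 hP.2).2.symm

theorem concaveOn_re_trace_rpow_mul_rpow {p : ℝ} (hp : p ∈ Icc 0 1) (K : Matrix m n 𝕜) :
    ConcaveOn ℝ ({A : Matrix m m 𝕜 | A.PosSemidef} ×ˢ {X : Matrix n n 𝕜 | X.PosSemidef})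
      fun P => RCLike.re (Kᴴ * P.1 ^ p * K * P.2 ^ (1 - p)).trace := by
  have hconvex := (convex_setOf_posSemidef (𝕜 := 𝕜) (m := m)).prod
    (convex_setOf_posSemidef (𝕜 := 𝕜) (m := n))
  rcases hp.1.eq_or_lt with rfl | hp0
  · refine (concaveOn_re_trace_add_re_trace_smul hconvex 0 K 1).congr fun P hP => ?_
    simp [CFC.rpow_zero P.1 hP.1.nonneg, CFC.rpow_one P.2 hP.2.nonneg]
  rcases hp.2.eq_or_lt with rfl | hp1
  · refine (concaveOn_re_trace_add_re_trace_smul hconvex K 0 1).congr fun P hP => ?_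
    simp [CFC.rpow_one P.1 hP.1.nonneg, CFC.rpow_zero P.2 hP.2.nonneg]
  · exact concaveOn_re_trace_rpow_mul_rpow_of_mem_Ioo ⟨hp0, hp1⟩ K

theorem re_trace_mul_rpow_one_sub_le {Y X : Matrix n n 𝕜} (hY : Y.PosSemidef) (hX : X.PosSemidef)
    {p : ℝ} (hp : p ∈ Ioc 0 1) :
    RCLike.re (Y * X ^ (1 - p)).trace ≤
      p * RCLike.re (Y ^ (1 / p)).trace + (1 - p) * RCLike.re X.trace := by
  have hYX := re_trace_rpow_mul_rpow hY hX 1 (1 - p) 1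
  have hYp := re_trace_rpow_mul_rpow hY hX (1 / p) 0 1
  have hXtr := re_trace_rpow_mul_rpow hY hX 0 1 1
  simp only [Matrix.conjTranspose_one, one_mul, mul_one, CFC.rpow_zero _ hY.nonneg,
    CFC.rpow_zero _ hX.nonneg, CFC.rpow_one _ hY.nonneg, CFC.rpow_one _ hX.nonneg,
    Real.rpow_zero, Real.rpow_one] at hYX hYp hXtr
  rw [hYX, hYp, hXtr]
  simp only [Finset.mul_sum, ← Finset.sum_add_distrib, ← mul_assoc, ← add_mul]
  gcongr with i _ j _
  exact mul_rpow_one_sub_le hp (hY.eigenvalues_nonneg i) (hX.eigenvalues_nonneg j)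

theorem mul_rpow_one_div_rpow_one_sub {Y : Matrix n n 𝕜} (hY : Y.PosSemidef) {p : ℝ}
    (hp : p ∈ Ioc 0 1) : Y * (Y ^ (1 / p)) ^ (1 - p) = Y ^ (1 / p) := by
  have hp0 : 0 ≤ 1 / p := one_div_nonneg.2 hp.1.le
  have hp1 : 0 ≤ 1 - p := sub_nonneg.2 hp.2
  calc Y * (Y ^ (1 / p)) ^ (1 - p)
      = Y ^ (1 : ℝ) * Y ^ (1 / p * (1 - p)) := by
        rw [CFC.rpow_one Y hY.nonneg, CFC.rpow_rpow_of_exponent_nonneg Y _ _ hp0 hp1 hY.nonneg]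
    _ = Y ^ (1 + 1 / p * (1 - p)) :=
        (rpow_add_of_exponent_nonneg Y zero_le_one (mul_nonneg hp0 hp1)).symm
    _ = Y ^ (1 / p) := by
        rw [mul_one_sub, one_div_mul_cancel hp.1.ne', add_sub_cancel]

theorem isGreatest_image_re_trace_mul_rpow_one_sub {Y : Matrix n n 𝕜} (hY : Y.PosSemidef) {p : ℝ}
    (hp : p ∈ Ioc 0 1) :
    IsGreatest
      ((fun X => RCLike.re (Y * X ^ (1 - p)).trace - (1 - p) * RCLike.re X.trace) ''
        {X : Matrix n n 𝕜 | X.PosSemidef})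
      (p * RCLike.re (Y ^ (1 / p)).trace) := by
  constructor
  · refine ⟨Y ^ (1 / p), Matrix.nonneg_iff_posSemidef.1 CFC.rpow_nonneg, ?_⟩
    simp only [mul_rpow_one_div_rpow_one_sub hY hp]
    ring
  · rintro _ ⟨X, hX, rfl⟩
    exact sub_le_iff_le_add.2 (re_trace_mul_rpow_one_sub_le hY hX hp)

theorem mainTheorem2_general (B : Matrix m n 𝕜) {p : ℝ} (hp0 : 0 ≤ p) (hp1 : p ≤ 1) :
    ConcaveOn ℝ {A : Matrix m m 𝕜 | A.PosSemidef}
      fun A => RCLike.re ((Bᴴ * A ^ p * B) ^ (1 / p)).trace := by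
  have hY (A : Matrix m m 𝕜) : (Bᴴ * A ^ p * B).PosSemidef :=
    (Matrix.nonneg_iff_posSemidef.1 CFC.rpow_nonneg).conjTranspose_mul_mul_same B
  rcases hp0.eq_or_lt with rfl | hp0
  · refine (concaveOn_const (RCLike.re (1 : Matrix n n 𝕜).trace) convex_setOf_posSemidef).congr
      fun A _ => ?_
    rw [div_zero, CFC.rpow_zero _ (hY A).nonneg]
  have hjoint := (concaveOn_re_trace_rpow_mul_rpow ⟨hp0.le, hp1⟩ B).sub
    (convexOn_mul_re_trace_snd (convex_setOf_posSemidef.prod convex_setOf_posSemidef) (1 - p))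
  have hmax := concaveOn_of_forall_isGreatest_image hjoint fun A _ =>
    isGreatest_image_re_trace_mul_rpow_one_sub (hY A) ⟨hp0, hp1⟩
  exact (hmax.smul (inv_nonneg.2 hp0.le)).congr fun A _ => inv_mul_cancel_left₀ hp0.ne' _

theorem mainTheorem2 (n : ℕ) (B : Matrix (Fin n) (Fin n) ℂ) (p : ℝ) (hp0 : 0 ≤ p) (hp1 : p ≤ 1) :
    ConcaveOn ℝ {A : Matrix (Fin n) (Fin n) ℂ | A.PosSemidef} (epsteinTrace B p) :=
  mainTheorem2_general B hp0 hp1
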